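/- Conventions. A \emph{Borel groupoid} is a small category $G$ in which every arrow is invertible, endowed with a standard Borel structure on its set of arrows such that composition (on the set of composable pairs) and inversion are Borel and the set $G^0$ of objects, identified with the identity arrows, is a Borel subset. It is \emph{countable} if for each object $x$ there are only countably many arrows with source $x$. Its \emph{orbit equivalence relation} $E_G$ on $G^0$ relates $x$ and $y$ when there is an arrow from $x$ to $y$. $G$ is \emph{Borel reducible} to $H$ if there is a functor $F$ from $G$ to $H$, Borel as a map between the spaces of arrows, such that for all objects $x,y$ of $G$, if there is an arrow in $H$ from $F(x)$ to $F(y)$ then there is an arrow in $G$ from $x$ to $y$. A countable Borel equivalence relation on a standard Borel space $X$ is an equivalence relation that is a Borel subset of $X\times X$ and has countable classes; it is \emph{treeable} if there is a Borel acyclic graph on $X$ whose connected components are exactly its classes. It is regarded as a principal groupoid with object space $X$, whose set of arrows is $E\subseteq X\times X$. The \emph{action groupoid} $\Gamma\ltimes X$ of a Borel action of a countable discrete group $\Gamma$ on $X$ has object space $X$ and arrows $\Gamma\times X$, where $(g,x)$ has source $x$ and range $gx$, and $(h,gx)(g,x)=(hg,x)$. Let $\mathbb{F}_\infty$ be the free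 group on countably infinitely many generators. Statement. Let $E$ be a countable Borel equivalence relation on a standard Borel space $X$ that is not treeable. Then there are countable Borel groupoids $G$ and $H$ with object space $X$, both with orbit equivalence relation $E$, such that $G$ is not Borel reducible to $H$. Moreover one can take $G=E$ (as a principal groupoid) and $H=\mathbb{F}_\infty\ltimes X$ for some Borel action of $\mathbb{F}_\infty$ on $X$ whose orbit equivalence relation is $E$. -/

import Mathlib

open CategoryTheory

universe u v

/-- A (standard) Borel groupoid with space of objects `X`: a small category on `X` in which every
arrow is invertible, with a standard Borel structure on the set of all arrows for which inversion
and composition are Borel. The last field says that `X`, identified with the set of identity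
arrows, is a Borel subset of the space of arrows and carries the induced Borel structure. -/
structure BorelGroupoid (X : Type u) [MeasurableSpace X] where
  [groupoid : Groupoid.{v} X]
  [measurableSpaceArrow : MeasurableSpace (Arrow X)]
  standardBorelSpace_arrow : StandardBorelSpace (Arrow X)
  /-- Composition `(γ, ρ) ↦ γρ` is Borel on the set of pairs with `s(γ) = r(ρ)`. -/
  measurable_comp : Measurable
    (fun p : {p : Arrow X × Arrow X // p.2.right = p.1.left} =>
      Arrow.mk (p.1.2.hom ≫ eqToHom p.2 ≫ p.1.1.hom))
  measurable_inv : Measurable (fun γ : Arrow X => Arrow.mk (Groupoid.inv γ.hom))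
  measurableEmbedding_id : MeasurableEmbedding (fun x : X => Arrow.mk (𝟙 x))

namespace BorelGroupoid

variable {X : Type u} [MeasurableSpace X]

/-- The objects of `G`: the set `X`, with the groupoid structure of `G`. -/
def Obj (_ : BorelGroupoid.{u, v} X) : Type u := X

instance (G : BorelGroupoid.{u, v} X) : Groupoid.{v} G.Obj := G.groupoid

instance (G : BorelGroupoid.{u, v} X) : MeasurableSpace (Arrow G.Obj) := G.measurableSpaceArrow

/-- The orbit equivalence relation: two objects are equivalent iff there is an arrow from one to
the other. -/
def orbitRel (G : BorelGroupoid.{u, v} X) : Setoid X where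
  r x y := Nonempty ((show G.Obj from x) ⟶ (show G.Obj from y))
  iseqv :=
    { refl := fun x => ⟨𝟙 (show G.Obj from x)⟩
      symm := fun ⟨f⟩ => ⟨Groupoid.inv f⟩
      trans := fun ⟨f⟩ ⟨g⟩ => ⟨f ≫ g⟩ }

/-- `G` is countable: for each object `x` there are countably many arrows with source `x`. -/
def IsCountable (G : BorelGroupoid.{u, v} X) : Prop :=
  ∀ x : G.Obj, {γ : Arrow G.Obj | γ.left = x}.Countable

/-- `G` is Borel reducible to `H`: there is a functor `F` from `G` to `H` that is Borel as a map
between the spaces of arrows, such that there is an arrow from `x` to `y` whenever there is one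
from `F x` to `F y`. -/
def BorelReducible {Y : Type*} [MeasurableSpace Y] (G : BorelGroupoid.{u, v} X)
    (H : BorelGroupoid Y) : Prop :=
  ∃ F : G.Obj ⥤ H.Obj, Measurable (fun γ : Arrow G.Obj => Arrow.mk (F.map γ.hom)) ∧
    ∀ x y : G.Obj, Nonempty (F.obj x ⟶ F.obj y) → Nonempty (x ⟶ y)

end BorelGroupoid

theorem standardBorelSpace_comap {α β : Type*} [MeasurableSpace β] [h : StandardBorelSpace β]
    (e : α ≃ β) : @StandardBorelSpace α (MeasurableSpace.comap e inferInstance) := by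
  obtain ⟨t, ht, hp⟩ := h.polish
  refine @StandardBorelSpace.mk α (_) ⟨t.induced e, ?_, ?_⟩
  · refine @BorelSpace.mk α (_) (_) ?_
    rw [ht.measurable_eq, borel_comap]
  · exact e.polishSpace_induced

section EquivalenceRelations

variable {X : Type u} [MeasurableSpace X]

/-- `E` is a countable Borel equivalence relation: it is a Borel subset of `X × X` and all its
classes are countable. -/
structure IsCountableBorel (E : Setoid X) : Prop where
  measurableSet : MeasurableSet {p : X × X | E p.1 p.2}
  countable_class : ∀ x : X, {y : X | E x y}.Countable

/-- `E` is treeable: there is a Borel acyclic graph on `X` whose connected components are the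
classes of `E`. -/
def IsTreeable (E : Setoid X) : Prop :=
  ∃ T : SimpleGraph X, MeasurableSet {p : X × X | T.Adj p.1 p.2} ∧ T.IsAcyclic ∧
    ∀ x y : X, T.Reachable x y ↔ E x y

/-- The equivalence relation `E` as a principal groupoid: there is exactly one arrow from `x` to
`y` if `x` and `y` are equivalent, and none otherwise. -/
abbrev principalGroupoid (E : Setoid X) : Groupoid.{0} X where
  Hom x y := PLift (E x y)
  id x := ⟨E.refl x⟩
  comp f g := ⟨E.trans f.down g.down⟩
  inv f := ⟨E.symm f.down⟩

/-- The arrows of the principal groupoid are the elements of `E` as a subset of `X × X`. -/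
def principalArrowEquiv (E : Setoid X) :
    letI := principalGroupoid E
    Arrow X ≃ {p : X × X // E p.1 p.2} :=
  letI := principalGroupoid E
  { toFun := fun γ => ⟨(γ.left, γ.right), γ.hom.down⟩
    invFun := fun p => Arrow.mk (X := p.1.1) (Y := p.1.2) ⟨p.2⟩
    left_inv := fun _ => rfl
    right_inv := fun _ => rfl }

/-- The Borel equivalence relation `E` as a principal Borel groupoid; the Borel structure on the
arrows is that of `E` as a subset of `X × X`. -/
def principalBorelGroupoid [StandardBorelSpace X] (E : Setoid X)
    (hE : MeasurableSet {p : X × X | E p.1 p.2}) : BorelGroupoid.{u, 0} X :=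
  letI := principalGroupoid E
  letI : MeasurableSpace (Arrow X) :=
    MeasurableSpace.comap (principalArrowEquiv E) inferInstance
  have hm : Measurable (principalArrowEquiv E) := comap_measurable _
  have hl : Measurable (fun γ : Arrow X => γ.left) :=
    measurable_fst.comp (measurable_subtype_coe.comp hm)
  have hr : Measurable (fun γ : Arrow X => γ.right) :=
    measurable_snd.comp (measurable_subtype_coe.comp hm)
  have hsb : StandardBorelSpace (Arrow X) :=
    have : StandardBorelSpace {p : X × X // E p.1 p.2} := hE.standardBorel
    standardBorelSpace_comap (principalArrowEquiv E)
  { standardBorelSpace_arrow := hsb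
    measurable_comp := measurable_comap_iff.2 <| Measurable.subtype_mk <|
      (hl.comp (measurable_snd.comp measurable_subtype_coe)).prodMk
        (hr.comp (measurable_fst.comp measurable_subtype_coe))
    measurable_inv := measurable_comap_iff.2 <| Measurable.subtype_mk <| hr.prodMk hl
    measurableEmbedding_id := Measurable.measurableEmbedding
      (measurable_comap_iff.2 <| Measurable.subtype_mk <| measurable_id.prodMk measurable_id)
      (fun _ _ h => congrArg (fun γ : Arrow X => γ.left) h) }

end EquivalenceRelations

section Actions

variable (Γ : Type v) [Group Γ] (X : Type u) [MulAction Γ X]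

/-- The action groupoid of an action of `Γ` on `X`: the arrows from `x` to `y` are the `g` in `Γ`
with `g • x = y`, and they are composed as elements of `Γ`. -/
abbrev actionGroupoid : Groupoid.{v} X where
  Hom x y := {g : Γ // g • x = y}
  id x := ⟨1, one_smul Γ x⟩
  comp f g := ⟨g.1 * f.1, by rw [mul_smul, f.2, g.2]⟩
  id_comp _ := Subtype.ext (mul_one _)
  comp_id _ := Subtype.ext (one_mul _)
  assoc _ _ _ := Subtype.ext (mul_assoc _ _ _).symm
  inv f := ⟨f.1⁻¹, by rw [inv_smul_eq_iff, f.2]⟩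
  inv_comp _ := Subtype.ext (mul_inv_cancel _)
  comp_inv _ := Subtype.ext (inv_mul_cancel _)

/-- The arrows of the action groupoid are the pairs `(g, x)` in `Γ × X`; such an arrow has source
`x` and range `g • x`. -/
def actionArrowEquiv :
    letI := actionGroupoid Γ X
    Arrow X ≃ Γ × X :=
  letI := actionGroupoid Γ X
  { toFun := fun γ => (γ.hom.1, γ.left)
    invFun := fun p => Arrow.mk (X := p.2) (Y := p.1 • p.2) ⟨p.1, rfl⟩
    left_inv := by
      rintro ⟨x, y, g, (h : g • x = y)⟩
      subst h
      rfl
    right_inv := fun _ => rfl }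

theorem actionArrowEquiv_comp :
    letI := actionGroupoid Γ X
    ∀ (γ ρ : Arrow X) (h : ρ.right = γ.left),
      actionArrowEquiv Γ X (Arrow.mk (ρ.hom ≫ eqToHom h ≫ γ.hom)) =
        ((actionArrowEquiv Γ X γ).1 * (actionArrowEquiv Γ X ρ).1, (actionArrowEquiv Γ X ρ).2) := by
  rintro ⟨_, z, g⟩ ⟨x, y, f⟩ h
  cases h
  exact Prod.ext (congrArg (· * f.1) (mul_one g.1)) rfl

variable [Countable Γ] [MeasurableSpace Γ] [DiscreteMeasurableSpace Γ]
  [MeasurableSpace X] [StandardBorelSpace X] [MeasurableSMul₂ Γ X]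

/-- The action groupoid of a Borel action of a countable group `Γ` on a standard Borel space `X`
as a Borel groupoid; the Borel structure on the arrows is that of `Γ × X`. -/
def actionBorelGroupoid : BorelGroupoid.{u, v} X :=
  letI := actionGroupoid Γ X
  letI : MeasurableSpace (Arrow X) :=
    MeasurableSpace.comap (actionArrowEquiv Γ X) inferInstance
  have hm : Measurable (actionArrowEquiv Γ X) := comap_measurable _
  have hg : Measurable (fun γ : Arrow X => (actionArrowEquiv Γ X γ).1) := measurable_fst.comp hm
  have hl : Measurable (fun γ : Arrow X => (actionArrowEquiv Γ X γ).2) := measurable_snd.comp hm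
  have hr : Measurable (fun γ : Arrow X => γ.right) := by
    have h : (fun γ : Arrow X => γ.right) =
        fun γ => (actionArrowEquiv Γ X γ).1 • (actionArrowEquiv Γ X γ).2 :=
      funext fun γ => γ.hom.2.symm
    rw [h]
    exact hg.smul hl
  have hsb : StandardBorelSpace (Arrow X) := standardBorelSpace_comap (actionArrowEquiv Γ X)
  { standardBorelSpace_arrow := hsb
    measurable_comp := by
      refine measurable_comap_iff.2 ?_
      have h1 := hg.comp (measurable_fst.comp
        (measurable_subtype_coe (p := fun p : Arrow X × Arrow X => p.2.right = p.1.left)))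
      have h2 := hm.comp (measurable_snd.comp
        (measurable_subtype_coe (p := fun p : Arrow X × Arrow X => p.2.right = p.1.left)))
      convert ((h1.mul (measurable_fst.comp h2)).prodMk (measurable_snd.comp h2)) using 1
      exact funext fun p => actionArrowEquiv_comp Γ X p.1.1 p.1.2 p.2
    measurable_inv := measurable_comap_iff.2 <| hg.inv.prodMk hr
    measurableEmbedding_id := Measurable.measurableEmbedding
      (measurable_comap_iff.2 <| measurable_const.prodMk measurable_id)
      (fun _ _ h => congrArg (fun γ : Arrow X => γ.left) h) }

end Actions

/-- The free group on countably infinitely many generators is a discrete group. -/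
instance : MeasurableSpace (FreeGroup ℕ) := ⊤

instance : DiscreteMeasurableSpace (FreeGroup ℕ) := ⟨fun _ => trivial⟩

/-! A Borel functor from `E` to an action groupoid of `FreeGroup ℕ` amounts to a Borel map `f` with
a Borel cocycle `c` on `E` such that `c x y • f x = f y`. For a reduction, `f x = f y` implies `E x
y`, so `f` is countable-to-one. Lusin–Novikov then gives a Borel `i : X → ℕ` such that `f` is
injective on each level set of `i`. Hence `c x y = 1` and `i x = i y` force `x = y`.

Such a pair `(c, i)` makes `E` treeable (`isTreeable_of_cocycle`). Fix `x`; then `y ↦ c x y` places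
the class of `x` in the Cayley tree of the free group, and a change of `x` only translates the
picture by an automorphism on the right. Assign to each vertex the nearest point of the class, with
ties broken by shortlex order and then by `i`. The sets of vertices assigned to a common point are
connected (`FreeGroup.reflTransGen_of_nearest`), so contracting them yields a tree
(`SimpleGraph.contract_isAcyclic`). A point that is assigned to no vertex shares its vertex with a
point of smaller `i`, and is hung as a leaf on the point assigned to that vertex. Nothing depends on
the base point, so this is a Borel treeing of `E`.

A non-treeable `E` therefore reduces to no action groupoid of `FreeGroup ℕ`. An action with orbit
relation `E` exists by Feldman–Moore: the generators act by involutions whose graphs cover `E`. -/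

/-! ### Lusin–Novikov for countable-to-one Borel maps -/

open MeasureTheory in
/-- Two disjoint-image analytic pieces can be separated, so an analytic set on which `f` is
injective is contained in a Borel set on which `f` is injective. -/
theorem exists_measurableSet_injOn_of_analyticSet {Z Y : Type*} [TopologicalSpace Z] [PolishSpace Z]
    [MeasurableSpace Z] [BorelSpace Z] [TopologicalSpace Y] [T2Space Y] [MeasurableSpace Y]
    [BorelSpace Y] {f : Z → Y} (hf : Continuous f) {A : Set Z} (hA : AnalyticSet A)
    (hinj : Set.InjOn f A) : ∃ B, MeasurableSet B ∧ Set.InjOn f B ∧ A ⊆ B := by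
  let 𝓒 := TopologicalSpace.countableBasis Z
  have hB := TopologicalSpace.isBasis_countableBasis Z
  have hanal : ∀ U ∈ 𝓒, AnalyticSet (f '' (A ∩ U)) := fun U hU => by
    refine AnalyticSet.image_of_continuous ?_ hf
    rw [Set.inter_eq_iInter]
    refine AnalyticSet.iInter fun b => ?_
    cases b
    · exact (hB.isOpen hU).measurableSet.analyticSet
    · exact hA
  -- Injectivity on `A` makes the images of `A ∩ U` and `A ∩ V` disjoint analytic sets, so Lusin
  -- separation applies.
  have hsep : ∀ p : {p : Set Z × Set Z // p.1 ∈ 𝓒 ∧ p.2 ∈ 𝓒 ∧ Disjoint p.1 p.2},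
      ∃ D : Set Y, MeasurableSet D ∧ f '' (A ∩ p.1.1) ⊆ D ∧ Disjoint (f '' (A ∩ p.1.2)) D := by
    rintro ⟨⟨U, V⟩, hU, hV, hUV⟩
    obtain ⟨D, h1, h2, h3⟩ := (hanal U hU).measurablySeparable (hanal V hV) (by
      rw [Set.disjoint_left]
      rintro _ ⟨z, ⟨hz, hzU⟩, rfl⟩ ⟨w, ⟨hw, hwV⟩, hzw⟩
      rw [hinj hw hz hzw] at hwV
      exact Set.disjoint_left.1 hUV hzU hwV)
    exact ⟨D, h3, h1, h2⟩
  choose D hDm hD1 hD2 using hsep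
  have : Countable {p : Set Z × Set Z // p.1 ∈ 𝓒 ∧ p.2 ∈ 𝓒 ∧ Disjoint p.1 p.2} := by
    refine Set.Countable.to_subtype (Set.Countable.mono ?_
      ((TopologicalSpace.countable_countableBasis Z).prod
        (TopologicalSpace.countable_countableBasis Z)))
    rintro p ⟨h1, h2, -⟩
    exact ⟨h1, h2⟩
  -- For each pair `U`, `V` of disjoint basic sets, points of `U` must map into `D` and points of
  -- `V` outside it; distinct points lie in such a pair.
  refine ⟨⋂ p, ((p.1.1ᶜ ∪ f ⁻¹' D p) ∩ (p.1.2ᶜ ∪ f ⁻¹' (D p)ᶜ)), ?_, ?_, ?_⟩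
  · refine MeasurableSet.iInter fun p => ?_
    have h1 := (hB.isOpen p.2.1).measurableSet
    have h2 := (hB.isOpen p.2.2.1).measurableSet
    exact (h1.compl.union (hf.measurable (hDm p))).inter
      (h2.compl.union (hf.measurable (hDm p).compl))
  · intro z hz w hw hzw
    by_contra hne
    obtain ⟨U, V, hU, hV, hzU, hwV, hUV⟩ := t2_separation hne
    obtain ⟨U', hU', hzU', hU'U⟩ := hB.exists_subset_of_mem_open hzU hU
    obtain ⟨V', hV', hwV', hV'V⟩ := hB.exists_subset_of_mem_open hwV hV
    have hz' := (Set.mem_iInter.1 hz ⟨(U', V'), hU', hV', hUV.mono hU'U hV'V⟩).1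
    have hw' := (Set.mem_iInter.1 hw ⟨(U', V'), hU', hV', hUV.mono hU'U hV'V⟩).2
    have h1 := hz'.resolve_left (fun h => h hzU')
    have h2 := hw'.resolve_left (fun h => h hwV')
    rw [Set.mem_preimage] at h1 h2
    rw [hzw] at h1
    exact h2 h1
  · intro z hz
    refine Set.mem_iInter.2 fun p => ⟨?_, ?_⟩
    · by_cases h : z ∈ p.1.1
      · exact Or.inr (hD1 p ⟨z, ⟨hz, h⟩, rfl⟩)
      · exact Or.inl h
    · by_cases h : z ∈ p.1.2
      · exact Or.inr (Set.disjoint_left.1 (hD2 p) ⟨z, ⟨hz, h⟩, rfl⟩)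
      · exact Or.inl h

/-- `S` is a countable union of Borel sets on which `f` is injective. -/
def IsCountablyInjective {Z Y : Type*} [MeasurableSpace Z] (f : Z → Y) (S : Set Z) : Prop :=
  ∃ 𝓑 : Set (Set Z), 𝓑.Countable ∧ (∀ B ∈ 𝓑, MeasurableSet B ∧ Set.InjOn f B) ∧ S = ⋃₀ 𝓑

namespace IsCountablyInjective

variable {Z Y : Type*} [MeasurableSpace Z] {f : Z → Y}

theorem measurableSet {S : Set Z} (h : IsCountablyInjective f S) : MeasurableSet S := by
  obtain ⟨𝓑, hc, hB, rfl⟩ := h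
  exact MeasurableSet.sUnion hc fun B hb => (hB B hb).1

theorem of_injOn {B : Set Z} (hB : MeasurableSet B) (hi : Set.InjOn f B) :
    IsCountablyInjective f B :=
  ⟨{B}, Set.countable_singleton B, by rintro _ rfl; exact ⟨hB, hi⟩, by simp⟩

theorem iUnion {ι : Type*} [Countable ι] {S : ι → Set Z} (h : ∀ i, IsCountablyInjective f (S i)) :
    IsCountablyInjective f (⋃ i, S i) := by
  choose 𝓑 hc hB hS using h
  refine ⟨⋃ i, 𝓑 i, Set.countable_iUnion hc, ?_, ?_⟩
  · intro B hb
    obtain ⟨i, hi⟩ := Set.mem_iUnion.1 hb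
    exact hB i B hi
  · rw [Set.sUnion_iUnion]
    exact Set.iUnion_congr hS

theorem union {S T : Set Z} (hS : IsCountablyInjective f S) (hT : IsCountablyInjective f T) :
    IsCountablyInjective f (S ∪ T) := by
  rw [Set.union_eq_iUnion]
  exact iUnion fun b => by cases b <;> assumption

end IsCountablyInjective

/-- Even after removing any set in the σ-ideal of countably injective sets, some fibre of `f`
meets all the members of the family `U`. -/
def IsFiberLarge {Z Y ι : Type*} [MeasurableSpace Z] (f : Z → Y) (U : ι → Set Z) : Prop :=
  ∀ S, IsCountablyInjective f S → ∃ y, ∀ i, ∃ z ∈ U i, z ∉ S ∧ f z = y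

section LusinNovikov

variable {Z Y : Type*} [MetricSpace Z] [CompleteSpace Z] [SecondCountableTopology Z]
  [MeasurableSpace Z] [BorelSpace Z] [TopologicalSpace Y] [T2Space Y] [MeasurableSpace Y]
  [BorelSpace Y] {f : Z → Y}

-- There are only countably many candidate pairs cut out of `U j` by small disjoint balls with
-- centres in a dense sequence. If all fail, the union `T` of their exceptional sets is still
-- countably injective. Let `A` be the analytic set of points of `U j \ T` whose fibre meets every
-- `U i \ T`. If `f` were injective on `A`, a Borel set containing `A` could be added to `T`,
-- against largeness. So two points of `A` share a fibre, and balls around them give a candidate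
-- that does not fail.
open MeasureTheory Metric in
theorem IsFiberLarge.exists_split {ι : Type*} [Countable ι] [DecidableEq ι] (hf : Continuous f)
    {U : ι → Set Z} (hU : ∀ i, IsClosed (U i)) (hg : IsFiberLarge f U) {j k : ι} (hjk : j ≠ k)
    (hUjk : U j = U k) {ε : ℝ} (hε : 0 < ε) :
    ∃ V W : Set Z, IsClosed V ∧ IsClosed W ∧ V ⊆ U j ∧ W ⊆ U j ∧ Disjoint V W ∧
      (∃ c, V ⊆ closedBall c ε) ∧ (∃ c, W ⊆ closedBall c ε) ∧
      IsFiberLarge f (Function.update (Function.update U j V) k W) := by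
  obtain ⟨z₀⟩ : Nonempty Z := by
    obtain ⟨y, hy⟩ := hg ∅ ⟨∅, by simp⟩
    obtain ⟨z, -⟩ := hy j
    exact ⟨z⟩
  have : Nonempty ι := ⟨j⟩
  have : Nonempty Z := ⟨z₀⟩
  let d := TopologicalSpace.denseSeq Z
  by_contra hcon
  let Q := {p : (ℕ × ℕ) × ℕ // 1 / (p.2 + 1 : ℝ) ≤ ε ∧
    Disjoint (closedBall (d p.1.1) (1 / (p.2 + 1 : ℝ))) (closedBall (d p.1.2) (1 / (p.2 + 1 : ℝ)))}
  let V : Q → Set Z := fun p => U j ∩ closedBall (d p.1.1.1) (1 / (p.1.2 + 1 : ℝ))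
  let W : Q → Set Z := fun p => U j ∩ closedBall (d p.1.1.2) (1 / (p.1.2 + 1 : ℝ))
  have hbad : ∀ p : Q, ∃ S, IsCountablyInjective f S ∧
      ¬ ∃ y, ∀ i, ∃ z ∈ Function.update (Function.update U j (V p)) k (W p) i, z ∉ S ∧ f z = y := by
    intro p
    by_contra h
    push Not at h
    refine hcon ⟨V p, W p, (hU j).inter isClosed_closedBall, (hU j).inter isClosed_closedBall,
      Set.inter_subset_left, Set.inter_subset_left,
      p.2.2.mono Set.inter_subset_right Set.inter_subset_right,
      ⟨_, Set.inter_subset_right.trans (closedBall_subset_closedBall p.2.1)⟩,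
      ⟨_, Set.inter_subset_right.trans (closedBall_subset_closedBall p.2.1)⟩, h⟩
  choose S hS hSbad using hbad
  have hST := IsCountablyInjective.iUnion hS
  set T := ⋃ p, S p with hT
  let A : Set Z := ⋂ i, ((U j \ T) ∩ f ⁻¹' (f '' (U i \ T)))
  have hA : AnalyticSet A := by
    refine AnalyticSet.iInter fun i => ?_
    have h1 : ∀ i, AnalyticSet (U i \ T) := fun i =>
      ((hU i).measurableSet.diff hST.measurableSet).analyticSet
    have h2 : (U j \ T) ∩ f ⁻¹' (f '' (U i \ T)) =
        Prod.fst '' ({p : Z × Z | f p.1 = f p.2} ∩ ((U j \ T) ×ˢ (U i \ T))) := by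
      ext z
      simp only [Set.mem_inter_iff, Set.mem_preimage, Set.mem_image, Prod.exists, Set.mem_prod,
        Set.mem_ofPred_eq, exists_and_right, exists_eq_right]
      constructor
      · rintro ⟨hz, w, hw, hwz⟩
        exact ⟨w, hwz.symm, hz, hw⟩
      · rintro ⟨w, hwz, hz, hw⟩
        exact ⟨hz, w, hw, hwz.symm⟩
    rw [h2]
    refine (MeasurableSet.analyticSet ?_).image_of_continuous continuous_fst
    exact (isClosed_eq (hf.comp continuous_fst) (hf.comp continuous_snd)).measurableSet.inter
      (((hU j).measurableSet.diff hST.measurableSet).prod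
        ((hU i).measurableSet.diff hST.measurableSet))
  have hAinj : ¬ Set.InjOn f A := by
    intro hinj
    obtain ⟨B, hB, hBi, hAB⟩ := exists_measurableSet_injOn_of_analyticSet hf hA hinj
    obtain ⟨y, hy⟩ := hg _ (hST.union (.of_injOn hB hBi))
    obtain ⟨z, hz, hzT, rfl⟩ := hy j
    refine hzT (Or.inr (hAB (Set.mem_iInter.2 fun i => ⟨⟨hz, fun h => hzT (Or.inl h)⟩, ?_⟩)))
    obtain ⟨w, hw, hwT, hwz⟩ := hy i
    exact ⟨w, ⟨hw, fun h => hwT (Or.inl h)⟩, hwz⟩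
  simp only [Set.InjOn, not_forall] at hAinj
  obtain ⟨z, hz, w, hw, hzw, hne⟩ := hAinj
  -- With radius below `dist z w / 4`, balls whose centres are within one radius of `z` and `w` are
  -- disjoint.
  have hpos : 0 < min ε (dist z w / 4) := lt_min hε (by have := dist_pos.2 hne; linarith)
  obtain ⟨n, hn⟩ := exists_nat_one_div_lt hpos
  have hn0 : (0 : ℝ) < 1 / (n + 1 : ℝ) := by positivity
  obtain ⟨a, ha⟩ := (TopologicalSpace.denseRange_denseSeq Z).exists_dist_lt z hn0
  obtain ⟨b, hb⟩ := (TopologicalSpace.denseRange_denseSeq Z).exists_dist_lt w hn0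
  have hd := hn.trans_le (min_le_right _ _)
  let p : Q := ⟨((a, b), n), (hn.trans_le (min_le_left _ _)).le, by
    refine closedBall_disjoint_closedBall ?_
    have h1 := dist_triangle4 z (d a) (d b) w
    rw [dist_comm (d b) w] at h1
    change dist z (d a) < _ at ha
    change dist w (d b) < _ at hb
    dsimp only
    linarith⟩
  refine hSbad p ⟨f z, fun i => ?_⟩
  have hsub : ∀ {x}, x ∉ T → x ∉ S p := fun h h' => h (Set.mem_iUnion.2 ⟨p, h'⟩)
  rw [Set.mem_iInter] at hz hw
  by_cases hik : i = k
  · subst hik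
    rw [Function.update_self]
    exact ⟨w, ⟨(hw j).1.1, hb.le⟩, hsub (hw j).1.2, hzw.symm⟩
  rw [Function.update_of_ne hik]
  by_cases hij : i = j
  · subst hij
    rw [Function.update_self]
    exact ⟨z, ⟨(hz i).1.1, ha.le⟩, hsub (hz i).1.2, rfl⟩
  rw [Function.update_of_ne hij]
  obtain ⟨x, hx, hxz⟩ := (hz i).2
  exact ⟨x, hx.1, hsub hx.2, hxz⟩

open Metric in
/-- All the members of a finite family can be split simultaneously. -/
theorem IsFiberLarge.exists_split_all {ι : Type*} [Finite ι] (hf : Continuous f)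
    {U : ι → Set Z} (hU : ∀ i, IsClosed (U i)) (hg : IsFiberLarge f U) {ε : ℝ} (hε : 0 < ε) :
    ∃ V : ι × Bool → Set Z, (∀ q, IsClosed (V q)) ∧ IsFiberLarge f V ∧ (∀ q, V q ⊆ U q.1) ∧
      (∀ i, Disjoint (V (i, false)) (V (i, true))) ∧ ∀ q, ∃ c, V q ⊆ closedBall c ε := by
  classical
  -- `T` is the set of indices already split. Outside `T` both copies remain equal to `U q.1`, which
  -- is what `exists_split` requires of the next pair.
  have key : ∀ T : Set ι, T.Finite → ∃ V : ι × Bool → Set Z, (∀ q, IsClosed (V q)) ∧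
      IsFiberLarge f V ∧ (∀ q, V q ⊆ U q.1) ∧ (∀ i ∈ T, Disjoint (V (i, false)) (V (i, true))) ∧
      (∀ q, q.1 ∈ T → ∃ c, V q ⊆ closedBall c ε) ∧ ∀ q, q.1 ∉ T → V q = U q.1 := by
    intro T hT
    induction T, hT using Set.Finite.induction_on with
    | empty =>
      refine ⟨fun q => U q.1, fun q => hU _, fun S hS => ?_, fun _ => subset_rfl, by simp, by simp,
        fun _ _ => rfl⟩
      obtain ⟨y, hy⟩ := hg S hS
      exact ⟨y, fun q => hy q.1⟩
    | @insert a T haT _ ih =>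
      obtain ⟨V, hVc, hVg, hVU, hVd, hVs, hVe⟩ := ih
      obtain ⟨A, B, hA, hB, hAU, hBU, hAB, hAs, hBs, hg'⟩ := hVg.exists_split hf hVc
        (j := (a, false)) (k := (a, true)) (by simp) (by rw [hVe _ haT, hVe _ haT]) hε
      rw [hVe _ haT] at hAU hBU
      set V' := Function.update (Function.update V (a, false) A) (a, true) B with hV'
      have e1 : V' (a, true) = B := by simp [hV']
      have e2 : V' (a, false) = A := by simp [hV']
      have e3 : ∀ q : ι × Bool, q.1 ≠ a → V' q = V q := by
        intro q hq
        rw [hV', Function.update_of_ne (by rintro rfl; exact hq rfl),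
          Function.update_of_ne (by rintro rfl; exact hq rfl)]
      have cases_q : ∀ q : ι × Bool, q = (a, true) ∨ q = (a, false) ∨ q.1 ≠ a := by
        rintro ⟨i, b⟩
        by_cases h : i = a
        · cases b <;> simp [h]
        · simp [h]
      refine ⟨V', ?_, hg', ?_, ?_, ?_, ?_⟩
      · intro q
        rcases cases_q q with rfl | rfl | h
        · rwa [e1]
        · rwa [e2]
        · rw [e3 q h]; exact hVc q
      · intro q
        rcases cases_q q with rfl | rfl | h
        · rwa [e1]
        · rwa [e2]
        · rw [e3 q h]; exact hVU q
      · intro i hi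
        by_cases h : i = a
        · subst h; rwa [e1, e2]
        · rw [e3 _ h, e3 _ h]; exact hVd i (hi.resolve_left h)
      · intro q hq
        rcases cases_q q with rfl | rfl | h
        · rwa [e1]
        · rwa [e2]
        · rw [e3 q h]; exact hVs q (hq.resolve_left h)
      · intro q hq
        have h : q.1 ≠ a := fun h => hq (Or.inl h)
        rw [e3 q h]; exact hVe q fun h' => hq (Or.inr h')
  obtain ⟨V, h1, h2, h3, h4, h5, -⟩ := key Set.univ Set.finite_univ
  exact ⟨V, h1, h2, h3, fun i => h4 i trivial, fun q => h5 q trivial⟩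

open Metric Filter Topology in
/-- A fibre-large family has a Cantor scheme in a single fibre. -/
theorem exists_uncountable_fiber_of_isFiberLarge (hf : Continuous f)
    (hg : IsFiberLarge f (fun _ : Unit => (Set.univ : Set Z))) :
    ∃ y, ¬ (f ⁻¹' {y}).Countable := by
  let F (n : ℕ) := {U : List.Vector Bool n → Set Z // (∀ i, IsClosed (U i)) ∧ IsFiberLarge f U}
  have step : ∀ n, ∀ U : F n, ∃ V : List.Vector Bool n × Bool → Set Z, (∀ q, IsClosed (V q)) ∧
      IsFiberLarge f V ∧ (∀ q, V q ⊆ U.1 q.1) ∧ (∀ i, Disjoint (V (i, false)) (V (i, true))) ∧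
      ∀ q, ∃ c, V q ⊆ closedBall c (1 / (n + 1 : ℝ)) := fun n U =>
    U.2.2.exists_split_all hf U.2.1 (by positivity)
  choose V hVc hVg hVU hVd hVs using step
  let W : ∀ n, F n := Nat.rec ⟨fun _ => Set.univ, fun _ => isClosed_univ, fun S hS =>
      (hg S hS).imp fun y hy _ => hy ()⟩
    fun n U => ⟨fun l => V n U (l.tail, l.head), fun l => hVc n U _, fun S hS =>
      (hVg n U S hS).imp fun y hy l => hy _⟩
  let A : List Bool → Set Z := fun l => (W l.length).1 ⟨l, rfl⟩
  have hAcons : ∀ (b : Bool) (l : List Bool),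
      A (b :: l) = V l.length (W l.length) (⟨l, rfl⟩, b) := fun _ _ => rfl
  have hAW : ∀ (n : ℕ) (l : List.Vector Bool n), (W n).1 l = A l.1 := by
    rintro n ⟨l, rfl⟩
    rfl
  have hAc : ∀ l, IsClosed (A l) := fun l => (W l.length).2.1 _
  have hfib : ∀ n, ∃ y, ∀ l : List Bool, l.length = n → ∃ z ∈ A l, f z = y := by
    intro n
    obtain ⟨y, hy⟩ := (W n).2.2 ∅ ⟨∅, by simp⟩
    refine ⟨y, fun l hl => ?_⟩
    obtain ⟨z, hz, -, h⟩ := hy ⟨l, hl⟩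
    exact ⟨z, (hAW n ⟨l, hl⟩).subset hz, h⟩
  have hanti : CantorScheme.Antitone A := fun l b => by
    rw [hAcons]
    exact hVU l.length (W l.length) (⟨l, rfl⟩, b)
  have hdisj : CantorScheme.Disjoint A := by
    intro l a b hab
    have := hVd l.length (W l.length) ⟨l, rfl⟩
    change Disjoint (A (a :: l)) (A (b :: l))
    rw [hAcons, hAcons]
    cases a <;> cases b
    · exact absurd rfl hab
    · exact this
    · exact this.symm
    · exact absurd rfl hab
  have hdiam : CantorScheme.VanishingDiam A := by
    intro x
    rw [← tendsto_add_atTop_iff_nat 1]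
    have hlim : Tendsto (fun n : ℕ => ENNReal.ofReal (2 * (1 / (n + 1 : ℝ)))) atTop (𝓝 0) := by
      have := ENNReal.tendsto_ofReal
        ((tendsto_one_div_add_atTop_nhds_zero_nat (𝕜 := ℝ)).const_mul 2)
      simpa using this
    refine tendsto_of_tendsto_of_tendsto_of_le_of_le tendsto_const_nhds hlim
      (fun _ => bot_le) fun n => ?_
    obtain ⟨c, hc⟩ := hVs _ (W (PiNat.res x n).length) (⟨PiNat.res x n, rfl⟩, x n)
    rw [← hAcons, PiNat.res_length] at hc
    rw [PiNat.res_succ]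
    refine ediam_le_of_forall_dist_le fun a ha b hb => ?_
    have h1 := dist_triangle_right a b c
    have h2 := mem_closedBall.1 (hc ha)
    have h3 := mem_closedBall.1 (hc hb)
    linarith
  choose y hy using hfib
  have htotal := (hanti.closureAntitone hAc).map_of_vanishingDiam hdiam fun l =>
    let ⟨z, hz, _⟩ := hy _ l rfl; ⟨z, hz⟩
  let φ : (ℕ → Bool) → Z := fun x =>
    (CantorScheme.inducedMap A).2 ⟨x, by rw [htotal]; trivial⟩
  have hφ : ∀ x n, φ x ∈ A (PiNat.res x n) := fun x n => CantorScheme.map_mem _ n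
  have hinj : Function.Injective φ := fun x x' h => by
    have := hdisj.map_injective h
    exact congrArg Subtype.val this
  -- All sets of level `n` meet the fibre over the single point `y n`. Hence `y` converges to `f (φ
  -- x)` for every branch `x`, and uniqueness of limits puts all `φ x` in one fibre.
  have hlim : ∀ x, Tendsto y atTop (𝓝 (f (φ x))) := by
    intro x
    choose z hz hzy using fun n => hy n (PiNat.res x n) (PiNat.res_length x n)
    rw [← funext hzy]
    refine (hf.tendsto _).comp (Metric.tendsto_atTop.2 fun ε hε => ?_)
    obtain ⟨n, hn⟩ := hdiam.dist_lt ε hε x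
    refine ⟨n, fun m hm => hn _ ?_ _ (hφ x n)⟩
    have hmono : Antitone fun k : ℕ => A (PiNat.res x k) :=
      antitone_nat_of_succ_le fun k => hanti _ _
    exact hmono hm (hz m)
  refine ⟨f (φ fun _ => false), fun hc => ?_⟩
  have : (Set.univ : Set (ℕ → Bool)).Countable := by
    refine (Set.countable_of_injective_of_countable_image (f := φ) hinj.injOn (hc.mono ?_))
    rintro _ ⟨x, -, rfl⟩
    exact tendsto_nhds_unique (hlim x) (hlim _)
  rw [Set.countable_univ_iff] at this
  obtain ⟨s, hs⟩ := exists_surjective_nat (ℕ → Bool)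
  obtain ⟨n, hn⟩ := hs fun n => !(s n n)
  simpa using congrFun hn n

end LusinNovikov

open MeasureTheory in
/-- **Lusin–Novikov**: the domain of a countable-to-one Borel map is a countable union of Borel
sets on which the map is injective. -/
theorem exists_measurableSet_injOn_of_countable_fiber {Z Y : Type*} [MeasurableSpace Z]
    [StandardBorelSpace Z] [MeasurableSpace Y] [StandardBorelSpace Y] {f : Z → Y}
    (hf : Measurable f) (hc : ∀ y, (f ⁻¹' {y}).Countable) :
    ∃ B : ℕ → Set Z, (∀ n, MeasurableSet (B n)) ∧ (∀ n, Set.InjOn f (B n)) ∧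
      ⋃ n, B n = Set.univ := by
  let := upgradeStandardBorel Y
  let tZ := upgradeStandardBorel Z
  -- A finer Polish topology makes `f` continuous without changing the Borel sets.
  obtain ⟨t', hle, hcont, hpol⟩ := hf.exists_continuous
  have hbor : @BorelSpace Z t' _ := by
    refine @BorelSpace.mk _ t' _ ?_
    rw [eq_borel_upgradeStandardBorel Z]
    exact (borel_eq_borel_of_le hpol tZ.toPolishSpace hle).symm
  clear hle
  clear tZ
  let := t'
  let := TopologicalSpace.upgradeIsCompletelyMetrizable Z
  by_contra hcon
  have hlarge : IsFiberLarge f (fun _ : Unit => (Set.univ : Set Z)) := by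
    rintro S ⟨𝓑, hcount, hB, rfl⟩
    by_contra h
    push Not at h
    refine hcon ?_
    have hcov : ∀ z : Z, z ∈ ⋃₀ 𝓑 := fun z => by
      by_contra hz
      obtain ⟨-, h⟩ := h (f z)
      exact h z trivial hz rfl
    obtain ⟨e, he⟩ := (hcount.insert ∅).exists_eq_range (Set.insert_nonempty _ _)
    have hmem : ∀ n, MeasurableSet (e n) ∧ Set.InjOn f (e n) := fun n => by
      have : e n ∈ insert ∅ 𝓑 := he ▸ Set.mem_range_self n
      rcases this with h | h
      · rw [h]; simp
      · exact hB _ h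
    refine ⟨e, fun n => (hmem n).1, fun n => (hmem n).2, Set.eq_univ_of_forall fun z => ?_⟩
    obtain ⟨B, hb, hz⟩ := hcov z
    obtain ⟨n, rfl⟩ : B ∈ Set.range e := he ▸ Set.mem_insert_of_mem _ hb
    exact Set.mem_iUnion.2 ⟨n, hz⟩
  obtain ⟨y, hy⟩ := exists_uncountable_fiber_of_isFiberLarge hcont hlarge
  exact hy (hc y)

/-! ### The Feldman–Moore theorem -/

/-- A symmetric Borel set with at most one point in each section is the graph of a partial
involution, which extends to a Borel involution. -/
theorem exists_measurable_involutive_of_symmetric {X : Type*} [MeasurableSpace X]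
    [StandardBorelSpace X] {H : Set (X × X)} (hH : MeasurableSet H)
    (hinj : Set.InjOn Prod.fst H) (hsymm : ∀ x y, (x, y) ∈ H → (y, x) ∈ H) :
    ∃ g : X → X, Measurable g ∧ Function.Involutive g ∧ (∀ x y, (x, y) ∈ H → g x = y) ∧
      ∀ x, g x = x ∨ (x, g x) ∈ H := by
  classical
  let g : X → X := fun x => if h : ∃ y, (x, y) ∈ H then h.choose else x
  have hg : ∀ x y, (x, y) ∈ H → g x = y := fun x y hxy => by
    have h : ∃ y, (x, y) ∈ H := ⟨y, hxy⟩
    have h1 : g x = h.choose := dif_pos h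
    rw [h1]
    exact congrArg Prod.snd (hinj h.choose_spec hxy rfl)
  have hg' : ∀ x, (¬ ∃ y, (x, y) ∈ H) → g x = x := fun x h => dif_neg h
  have hor : ∀ x, g x = x ∨ (x, g x) ∈ H := fun x => by
    by_cases h : ∃ y, (x, y) ∈ H
    · obtain ⟨y, hy⟩ := h
      exact Or.inr ((hg x y hy).symm ▸ hy)
    · exact Or.inl (hg' x h)
  refine ⟨g, fun D hD => ?_, fun x => ?_, hg, hor⟩
  -- Injective Borel images of Borel sets are Borel (Lusin–Souslin).
  · have himg : ∀ S : Set X, MeasurableSet S →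
        MeasurableSet (Prod.fst '' (H ∩ Prod.snd ⁻¹' S)) := fun S hS =>
      (hH.inter (measurable_snd hS)).image_of_measurable_injOn measurable_fst
        (hinj.mono Set.inter_subset_left)
    have : g ⁻¹' D = Prod.fst '' (H ∩ Prod.snd ⁻¹' D) ∪
        (D \ Prod.fst '' (H ∩ Prod.snd ⁻¹' Set.univ)) := by
      ext x
      by_cases h : ∃ y, (x, y) ∈ H
      · obtain ⟨y, hy⟩ := h
        simp only [Set.mem_preimage, hg x y hy]
        constructor
        · intro h
          exact Or.inl ⟨(x, y), ⟨hy, h⟩, rfl⟩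
        · rintro (⟨⟨x', z⟩, ⟨hz, hzD⟩, rfl⟩ | h)
          · rw [← hg _ _ hy, hg _ _ hz]
            exact hzD
          · exact absurd ⟨(x, y), ⟨hy, trivial⟩, rfl⟩ h.2
      · simp only [Set.mem_preimage, hg' x h]
        constructor
        · intro hx
          refine Or.inr ⟨hx, ?_⟩
          rintro ⟨⟨x', z⟩, ⟨hz, -⟩, rfl⟩
          exact h ⟨z, hz⟩
        · rintro (⟨⟨x', z⟩, ⟨hz, hzD⟩, rfl⟩ | h)
          · exact absurd ⟨z, hz⟩ h
          · exact h.1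
    rw [this]
    exact (himg D hD).union (hD.diff (himg _ MeasurableSet.univ))
  · rcases hor x with h | h
    · rw [h, h]
    · exact hg _ _ (hsymm _ _ h)

/-- **Feldman–Moore**: a countable Borel equivalence relation is the union of the graphs of
countably many Borel involutions. -/
theorem IsCountableBorel.exists_involutive {X : Type u} [MeasurableSpace X] [StandardBorelSpace X]
    {E : Setoid X} (hE : IsCountableBorel E) :
    ∃ g : ℕ → X → X, (∀ n, Measurable (g n)) ∧ (∀ n, Function.Involutive (g n)) ∧
      ∀ x y, E x y ↔ ∃ n, g n x = y := by
  have hZ : StandardBorelSpace {p : X × X // E p.1 p.2} := hE.measurableSet.standardBorel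
  have hemb : MeasurableEmbedding (Subtype.val : {p : X × X // E p.1 p.2} → X × X) :=
    MeasurableEmbedding.subtype_coe hE.measurableSet
  have h1 : Measurable fun z : {p : X × X // E p.1 p.2} => z.1.1 :=
    measurable_fst.comp measurable_subtype_coe
  have h2 : Measurable fun z : {p : X × X // E p.1 p.2} => z.1.2 :=
    measurable_snd.comp measurable_subtype_coe
  obtain ⟨B, hB, hBi, hBU⟩ := exists_measurableSet_injOn_of_countable_fiber h1 fun x => by
    refine Set.countable_of_injective_of_countable_image (f := fun z => z.1.2) ?_
      ((hE.countable_class x).mono ?_)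
    · rintro ⟨⟨a, b⟩, h⟩ rfl ⟨⟨c, d⟩, h'⟩ hc hbd
      cases hc; cases hbd; rfl
    · rintro _ ⟨⟨⟨a, b⟩, h⟩, rfl, rfl⟩
      exact h
  obtain ⟨C, hC, hCi, hCU⟩ := exists_measurableSet_injOn_of_countable_fiber h2 fun x => by
    refine Set.countable_of_injective_of_countable_image (f := fun z => z.1.1) ?_
      ((hE.countable_class x).mono ?_)
    · rintro ⟨⟨a, b⟩, h⟩ rfl ⟨⟨c, d⟩, h'⟩ hc hbd
      cases hc; cases hbd; rfl
    · rintro _ ⟨⟨⟨a, b⟩, h⟩, rfl, rfl⟩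
      exact E.symm h
  obtain ⟨U, hU, hsep⟩ := exists_seq_separating X (p := MeasurableSet) MeasurableSet.empty Set.univ
  -- `B ∩ C` is injective in both coordinates. The factor `U ×ˢ Uᶜ` keeps domain and range disjoint,
  -- so that the union of `G i` with its transpose is still a graph.
  let G : (ℕ × ℕ) × ℕ → Set (X × X) := fun i =>
    Subtype.val '' (B i.1.1 ∩ C i.1.2) ∩ (U i.2 ×ˢ (U i.2)ᶜ)
  have hG : ∀ i, MeasurableSet (G i) := fun i =>
    (hemb.measurableSet_image.2 ((hB _).inter (hC _))).inter ((hU _).prod (hU _).compl)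
  have hGE : ∀ i x y, (x, y) ∈ G i → E x y := by
    rintro i x y ⟨⟨z, -, hz⟩, -⟩
    have := z.2
    rwa [hz] at this
  have hG1 : ∀ i x y z, (x, y) ∈ G i → (x, z) ∈ G i → y = z := by
    rintro i x y z ⟨⟨⟨_, ha⟩, ⟨hab, -⟩, rfl⟩, -⟩ ⟨⟨⟨_, hb⟩, ⟨hbb, -⟩, rfl⟩, -⟩
    have := hBi _ hab hbb rfl
    exact congrArg (fun z => z.1.2) this
  have hG2 : ∀ i x y z, (y, x) ∈ G i → (z, x) ∈ G i → y = z := by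
    rintro i x y z ⟨⟨⟨_, ha⟩, ⟨-, hab⟩, rfl⟩, -⟩ ⟨⟨⟨_, hb⟩, ⟨-, hbb⟩, rfl⟩, -⟩
    have := hCi _ hab hbb rfl
    exact congrArg (fun z => z.1.1) this
  have hinv : ∀ i, ∃ g : X → X, Measurable g ∧ Function.Involutive g ∧
      (∀ x y, (x, y) ∈ G i ∪ Prod.swap ⁻¹' G i → g x = y) ∧
      ∀ x, g x = x ∨ (x, g x) ∈ G i ∪ Prod.swap ⁻¹' G i := by
    intro i
    refine exists_measurable_involutive_of_symmetric
      ((hG i).union (measurable_swap (hG i))) ?_ ?_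
    · rintro ⟨x, y⟩ hy ⟨x', z⟩ hz (rfl : x = x')
      rcases hy with hy | hy <;> rcases hz with hz | hz
      · rw [hG1 i x y z hy hz]
      · exact absurd hy.2.1 hz.2.2
      · exact absurd hz.2.1 hy.2.2
      · rw [hG2 i x y z hy hz]
    · rintro x y (h | h)
      · exact Or.inr h
      · exact Or.inl h
  choose g hgm hgi hgG hgE using hinv
  have hcov : ∀ x y n, E x y → x ∈ U n → y ∉ U n → ∃ i, (x, y) ∈ G i := by
    intro x y n hxy hx hy
    obtain ⟨b, hb⟩ := Set.mem_iUnion.1 (hBU.ge (Set.mem_univ ⟨(x, y), hxy⟩))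
    obtain ⟨c, hc⟩ := Set.mem_iUnion.1 (hCU.ge (Set.mem_univ ⟨(x, y), hxy⟩))
    exact ⟨((b, c), n), ⟨_, ⟨hb, hc⟩, rfl⟩, hx, hy⟩
  -- The sets `G i` miss the diagonal; the index `none` supplies the identity.
  have hall : ∀ x y, E x y ↔ ∃ i : Option ((ℕ × ℕ) × ℕ), i.elim id g x = y := by
    intro x y
    constructor
    · intro hxy
      by_cases hne : x = y
      · exact ⟨none, hne⟩
      have : ∃ n, ¬ (x ∈ U n ↔ y ∈ U n) := by
        by_contra h
        push Not at h
        exact hne (hsep x trivial y trivial h)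
      obtain ⟨n, hn⟩ := this
      by_cases hx : x ∈ U n
      · obtain ⟨i, hi⟩ := hcov x y n hxy hx (by tauto)
        exact ⟨some i, hgG i x y (Or.inl hi)⟩
      · obtain ⟨i, hi⟩ := hcov y x n (E.symm hxy) (by tauto) hx
        exact ⟨some i, hgG i x y (Or.inr hi)⟩
    · rintro ⟨_ | i, rfl⟩
      · exact E.refl x
      · rcases hgE i x with h | h | h
        · change E x (g i x)
          rw [h]
        · exact hGE i _ _ h
        · exact E.symm (hGE i _ _ h)
  obtain ⟨e, he⟩ := exists_surjective_nat (Option ((ℕ × ℕ) × ℕ))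
  have hm : ∀ o : Option ((ℕ × ℕ) × ℕ), Measurable (o.elim id g) := by
    rintro (_ | i)
    · exact measurable_id
    · exact hgm i
  have hi : ∀ o : Option ((ℕ × ℕ) × ℕ), Function.Involutive (o.elim id g) := by
    rintro (_ | i)
    · exact fun _ => rfl
    · exact hgi i
  refine ⟨fun n => (e n).elim id g, fun n => hm _, fun n => hi _, fun x y => ?_⟩
  rw [hall, he.exists]

/-! ### Contraction of trees along connected fibres -/

namespace SimpleGraph

variable {V C : Type*}

/-- The graph on `C` obtained from a graph on `V` by contracting the fibres of `π : V → C`, and by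
attaching the remaining points `c` of `C` as leaves at `π (φ c)`. -/
def contract (T : SimpleGraph V) (φ : C → V) (π : V → C) : SimpleGraph C :=
  SimpleGraph.fromRel fun a b => (∃ v w, T.Adj v w ∧ π v = a ∧ π w = b) ∨ π (φ a) = b

variable {T : SimpleGraph V} {φ : C → V} {π : V → C}

/-- The path from `v` to `φ (π v)` stays in one fibre. Thus `c` is in the range of `π` exactly when
`π (φ c) = c`; the other points are the leaves. -/
theorem contract_proj (hπ : ∀ v, Relation.ReflTransGen (fun u w => T.Adj u w ∧ π u = π w) v
    (φ (π v))) (v : V) : π (φ (π v)) = π v := by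
  have : ∀ w, Relation.ReflTransGen (fun u w => T.Adj u w ∧ π u = π w) v w → π w = π v := by
    intro w hw
    induction hw with
    | refl => rfl
    | tail _ h ih => rw [← h.2, ih]
  exact this _ (hπ v)

theorem contract_reachable_of_reachable {v w : V} (h : T.Reachable v w) :
    (T.contract φ π).Reachable (π v) (π w) := by
  rw [reachable_iff_reflTransGen] at h
  induction h with
  | refl => rfl
  | @tail b c _ hbc ih =>
    refine ih.trans ?_
    by_cases hne : π b = π c
    · rw [hne]
    · exact Adj.reachable ((fromRel_adj _ _ _).2 ⟨hne, Or.inl (Or.inl ⟨b, c, hbc, rfl, rfl⟩)⟩)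

theorem contract_preconnected (hT : T.Preconnected) : (T.contract φ π).Preconnected := by
  have h : ∀ c, (T.contract φ π).Reachable c (π (φ c)) := fun c => by
    by_cases hne : c = π (φ c)
    · rw [← hne]
    · exact Adj.reachable ((fromRel_adj _ _ _).2 ⟨hne, Or.inl (Or.inr rfl)⟩)
  exact fun a b => (h a).trans ((contract_reachable_of_reachable (hT _ _)).trans (h b).symm)

/-- Every edge is a bridge. An edge that comes from `T.Adj v w` is one because a path avoiding it
lifts through `φ` to a path in `T` avoiding `s(v, w)`: fibres are connected by edges inside them,
and other contracted edges come from other edges of `T`. A point outside the range of `π` has a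
single edge. -/
theorem contract_isAcyclic (hT : T.IsAcyclic)
    (hπ : ∀ v, Relation.ReflTransGen (fun u w => T.Adj u w ∧ π u = π w) v (φ (π v))) :
    (T.contract φ π).IsAcyclic := by
  have main : ∀ a b, a ≠ b → ((∃ v w, T.Adj v w ∧ π v = a ∧ π w = b) ∨ π (φ a) = b) →
      (T.contract φ π).IsBridge s(a, b) := by
    rintro a b hne h
    rw [isBridge_iff]
    intro hreach
    by_cases ha : π (φ a) = a
    · obtain ⟨v, w, hvw, rfl, rfl⟩ := h.resolve_right (fun h => hne (ha.symm.trans h))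
      have hbr := isAcyclic_iff_forall_adj_isBridge.1 hT hvw
      rw [isBridge_iff] at hbr
      have hfib : ∀ u x, Relation.ReflTransGen (fun u w => T.Adj u w ∧ π u = π w) u x →
          (T.deleteEdges {s(v, w)}).Reachable u x := by
        intro u x hux
        induction hux with
        | refl => rfl
        | @tail y z _ hyz ih =>
          refine ih.trans (Adj.reachable ?_)
          rw [deleteEdges_adj]
          refine ⟨hyz.1, ?_⟩
          simp only [Set.mem_singleton_iff, Sym2.eq_iff]
          rintro (⟨rfl, rfl⟩ | ⟨rfl, rfl⟩)
          · exact hne hyz.2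
          · exact hne hyz.2.symm
      have hrel : ∀ c d, (∃ x y, T.Adj x y ∧ π x = c ∧ π y = d) ∨ π (φ c) = d →
          s(c, d) ≠ s(π v, π w) → (T.deleteEdges {s(v, w)}).Reachable (φ c) (φ d) := by
        rintro c d (⟨x, y, hxy, rfl, rfl⟩ | rfl) hcd
        · refine (hfib _ _ (hπ x)).symm.trans (Reachable.trans (Adj.reachable ?_) (hfib _ _ (hπ y)))
          rw [deleteEdges_adj]
          refine ⟨hxy, fun h => hcd ?_⟩
          have := congrArg (Sym2.map π) (Set.mem_singleton_iff.1 h)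
          simpa using this
        · exact hfib _ _ (hπ _)
      have hlift : ∀ c, ((T.contract φ π).deleteEdges {s(π v, π w)}).Reachable (π v) c →
          (T.deleteEdges {s(v, w)}).Reachable (φ (π v)) (φ c) := by
        intro c hc
        rw [reachable_iff_reflTransGen] at hc
        induction hc with
        | refl => rfl
        | @tail c d _ hcd ih =>
          refine ih.trans ?_
          rw [deleteEdges_adj, contract, fromRel_adj] at hcd
          obtain ⟨⟨-, h | h⟩, h'⟩ := hcd
          · exact hrel c d h h'
          · exact (hrel d c h fun e => h' (Sym2.eq_swap.trans e)).symm
      exact hbr ((hfib _ _ (hπ v)).trans ((hlift _ hreach).trans (hfib _ _ (hπ w)).symm))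
    · have hrange : ∀ v, π v ≠ a := by
        rintro v rfl
        exact ha (contract_proj hπ v)
      have hb : π (φ a) = b := by
        rcases h with ⟨v, w, -, h, -⟩ | h
        · exact absurd h (hrange v)
        · exact h
      have hstep : ∀ d, ¬ ((T.contract φ π).deleteEdges {s(a, b)}).Adj a d := by
        intro d had
        rw [deleteEdges_adj, contract, fromRel_adj] at had
        obtain ⟨⟨-, h | h⟩, h'⟩ := had
        · rcases h with ⟨v, w, -, h, -⟩ | h
          · exact hrange v h
          · exact h' (by rw [← h, hb]; rfl)
        · rcases h with ⟨v, w, -, -, h⟩ | h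
          · exact hrange w h
          · exact hrange _ h
      rw [reachable_iff_reflTransGen] at hreach
      rcases hreach.cases_head with h | ⟨d, hd, -⟩
      · exact hne h
      · exact hstep d hd
  rw [isAcyclic_iff_forall_adj_isBridge]
  intro a b hab
  rw [contract, fromRel_adj] at hab
  rcases hab with ⟨hne, h | h⟩
  · exact main a b hne h
  · rw [Sym2.eq_swap]
    exact main b a hne.symm h

end SimpleGraph

/-! ### The Cayley tree of a free group and nearest points -/

namespace FreeGroup

variable {α : Type*}

/-- The left Cayley graph of a free group: `u` is joined to `s * u` for each letter `s`. -/
def cayleyGraph (α : Type*) : SimpleGraph (FreeGroup α) :=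
  SimpleGraph.fromRel fun u v => ∃ s : α × Bool, mk [s] * u = v

theorem cayleyGraph_adj {u v : FreeGroup α} :
    (cayleyGraph α).Adj u v ↔ ∃ s : α × Bool, mk [s] * u = v := by
  classical
  rw [cayleyGraph, SimpleGraph.fromRel_adj]
  constructor
  · rintro ⟨-, h | ⟨s, rfl⟩⟩
    · exact h
    · refine ⟨(s.1, !s.2), ?_⟩
      have : mk [(s.1, !s.2)] = (mk [s])⁻¹ := by simp [inv_mk, invRev]
      rw [this, inv_mul_cancel_left]
  · rintro ⟨s, rfl⟩
    refine ⟨fun h => ?_, Or.inl ⟨s, rfl⟩⟩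
    have h1 : mk [s] = 1 := by simpa using h
    rw [← toWord_eq_nil_iff, toWord_mk, reduce_singleton] at h1
    exact List.cons_ne_nil _ _ h1

theorem cayleyGraph_preconnected : (cayleyGraph α).Preconnected := by
  have h : ∀ (L : List (α × Bool)) (u : FreeGroup α), (cayleyGraph α).Reachable u (mk L * u) := by
    intro L u
    induction L with
    | nil => rw [← one_eq_mk, one_mul]
    | cons s L ih =>
      refine ih.trans (SimpleGraph.Adj.reachable (cayleyGraph_adj.2 ⟨s, ?_⟩))
      rw [← mul_assoc, mul_mk]
      rfl
  intro u v
  classical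
  have := h (v * u⁻¹).toWord u
  rwa [mk_toWord, inv_mul_cancel_right] at this

/-- Left multiplication by a letter alters only the front of a reduced word, so it can create a new
last letter only from the empty word. -/
theorem eq_one_of_getLast?_toWord [DecidableEq α] {g : FreeGroup α} {s t : α × Bool}
    (h : (mk [t] * g).toWord.getLast? = some s) (hg : g.toWord.getLast? ≠ some s) :
    g = 1 ∧ t = s := by
  have h1 : (mk [t] * g).toWord = reduce (t :: g.toWord) := by
    conv_lhs => rw [← mk_toWord (x := g), mul_mk, toWord_mk]
    rfl
  rw [h1, reduce.cons, reduce_toWord] at h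
  rw [← toWord_eq_nil_iff]
  cases hL : g.toWord with
  | nil => rw [hL] at h; simpa using h
  | cons a L =>
    rw [hL] at h hg
    refine absurd ?_ hg
    dsimp only at h
    split_ifs at h with hc
    · rw [List.getLast?_cons, h]; rfl
    · rwa [List.getLast?_cons_cons] at h

/-- Without the edge from `u` to `mk [s] * u`, no vertex `w` reachable from `u` has `w * u⁻¹` ending
in `s`: by the preceding lemma, only that edge creates this ending. -/
theorem cayleyGraph_isAcyclic : (cayleyGraph α).IsAcyclic := by
  classical
  rw [SimpleGraph.isAcyclic_iff_forall_adj_isBridge]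
  intro u v huv
  obtain ⟨s, rfl⟩ := cayleyGraph_adj.1 huv
  rw [SimpleGraph.isBridge_iff]
  intro hreach
  have key : ∀ w, ((cayleyGraph α).deleteEdges {s(u, mk [s] * u)}).Reachable u w →
      (w * u⁻¹).toWord.getLast? ≠ some s := by
    intro w hw
    rw [SimpleGraph.reachable_iff_reflTransGen] at hw
    induction hw with
    | refl => simp
    | @tail x y _ hxy ih =>
      rw [SimpleGraph.deleteEdges_adj, cayleyGraph_adj] at hxy
      obtain ⟨⟨t, rfl⟩, hne⟩ := hxy
      intro h
      rw [mul_assoc] at h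
      obtain ⟨h1, rfl⟩ := eq_one_of_getLast?_toWord h ih
      rw [mul_inv_eq_one] at h1
      subst h1
      exact hne rfl
  refine key _ hreach ?_
  rw [mul_inv_cancel_right, toWord_mk, reduce_singleton]
  rfl

/-- The lexicographic order on pairs of an element of a free group and a natural number, where
the elements of the free group are ordered by the shortlex order of their reduced words. -/
def ShortlexLT [DecidableEq α] : FreeGroup α × ℕ → FreeGroup α × ℕ → Prop :=
  Prod.Lex (InvImage (List.Shortlex WellOrderingRel) toWord) (· < ·)

section

variable [DecidableEq α]

theorem shortlexLT_wellFounded : WellFounded (ShortlexLT (α := α)) :=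
  WellFounded.prod_lex (InvImage.wf _ (List.Shortlex.wf IsWellFounded.wf)) wellFounded_lt

theorem eq_of_not_shortlexLT {a b : FreeGroup α × ℕ} (h1 : ¬ ShortlexLT a b)
    (h2 : ¬ ShortlexLT b a) : a = b := by
  rw [ShortlexLT, Prod.lex_def] at h1 h2
  push Not at h1 h2
  have h : a.1 = b.1 := toWord_injective
    (Std.Trichotomous.trichotomous (r := List.Shortlex WellOrderingRel) _ _ h1.1 h2.1)
  exact Prod.ext h (le_antisymm (h2.2 h.symm) (h1.2 h))

theorem _root_.List.Lex.append_of_length_eq {β : Type*} {r : β → β → Prop} {s t : List β}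
    (h : List.Lex r s t) (hl : s.length = t.length) (u : List β) :
    List.Lex r (s ++ u) (t ++ u) := by
  induction h with
  | nil => simp at hl
  | cons _ ih => exact .cons (ih (by simpa using hl))
  | rel h => exact .rel h

/-- Either `s` cancels and the product is too short, or it is appended to both words and the
comparison persists. Used to carry a comparison of distances from `mk [s] * v` back to `v`. -/
theorem shortlex_toWord_mul {g : FreeGroup α} {L : List (α × Bool)} {s : α × Bool}
    (h : List.Shortlex WellOrderingRel g.toWord L) :
    List.Shortlex WellOrderingRel (g * mk [s]).toWord (L ++ [s]) := by
  have hsub : List.Sublist (g * mk [s]).toWord (g.toWord ++ [s]) := by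
    have := toWord_mul_sublist g (mk [s])
    rwa [toWord_mk, reduce_singleton] at this
  have hle := hsub.length_le
  rw [List.shortlex_def] at h ⊢
  simp only [List.length_append, List.length_singleton] at hle ⊢
  rcases h with h | ⟨h, hlex⟩
  · left; omega
  · rcases hle.lt_or_eq with h' | h'
    · left; omega
    · right
      rw [hsub.eq_of_length (by simpa using h')]
      exact ⟨by simpa using h, hlex.append_of_length_eq h _⟩

variable {C : Type*} {φ : C → FreeGroup α} {i : C → ℕ} {π : FreeGroup α → C}

/-- If `π v` is the point `c` that is nearest to `v` in the sense of `ShortlexLT`, then the fibres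
of `π` are connected in the Cayley graph. -/
theorem reflTransGen_of_nearest
    (hinj : ∀ a b, φ a = φ b → i a = i b → a = b)
    (hπ : ∀ v c, ¬ ShortlexLT (φ c * v⁻¹, i c) (φ (π v) * v⁻¹, i (π v))) (v : FreeGroup α) :
    Relation.ReflTransGen (fun u w => (cayleyGraph α).Adj u w ∧ π u = π w) v (φ (π v)) := by
  have huniq : ∀ v d, (∀ c, ¬ ShortlexLT (φ c * v⁻¹, i c) (φ d * v⁻¹, i d)) → π v = d := by
    intro v d hd
    have := eq_of_not_shortlexLT (hd (π v)) (hπ v d)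
    rw [Prod.mk.injEq, mul_left_inj] at this
    exact hinj _ _ this.1 this.2
  induction hn : (φ (π v) * v⁻¹).toWord.length generalizing v with
  | zero =>
    rw [List.length_eq_zero_iff, toWord_eq_nil_iff, mul_inv_eq_one] at hn
    rw [hn]
  | succ n ih =>
    -- The last letter `s` is the first step from `v` towards its nearest point. A point nearer to
    -- `mk [s] * v` would also be nearer to `v`, so `π` does not change along this step.
    obtain ⟨L, s, hL⟩ : ∃ L s, (φ (π v) * v⁻¹).toWord = L ++ [s] :=
      ⟨_, _, (List.dropLast_append_getLast (List.ne_nil_of_length_eq_add_one hn)).symm⟩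
    have hmk : φ (π v) * (mk [s] * v)⁻¹ = mk L := by
      have := mk_toWord (x := φ (π v) * v⁻¹)
      rw [hL, ← mul_mk] at this
      rw [mul_inv_rev, ← mul_assoc, ← this, mul_inv_cancel_right]
    have hred : (mk L).toWord = L := by
      rw [toWord_mk]
      have : IsReduced (L ++ [s]) := hL ▸ isReduced_toWord
      exact (this.infix (List.prefix_append _ _).isInfix).reduce_eq
    have hsel : π (mk [s] * v) = π v := by
      refine huniq _ _ fun c hc => hπ v c ?_
      have hc1 : φ c * v⁻¹ = φ c * (mk [s] * v)⁻¹ * mk [s] := by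
        rw [mul_inv_rev, ← mul_assoc, inv_mul_cancel_right]
      rw [ShortlexLT, Prod.lex_def] at hc ⊢
      rcases hc with hc | ⟨h1, h2⟩
      · left
        simp only [InvImage] at hc ⊢
        rw [hmk, hred] at hc
        rw [hL, hc1]
        exact shortlex_toWord_mul hc
      · right
        refine ⟨?_, h2⟩
        simp only [mul_left_inj] at h1 ⊢
        exact h1
    refine Relation.ReflTransGen.head ⟨cayleyGraph_adj.2 ⟨s, rfl⟩, hsel.symm⟩ ?_
    have := ih (mk [s] * v) (by
      rw [hsel, hmk, hred]
      rw [hL] at hn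
      simpa using hn)
    rwa [hsel] at this

end

end FreeGroup

/-! ### From a cocycle to a treeing -/

section Treeability

variable {X : Type u} (E : Setoid X) (c : X → X → FreeGroup ℕ) (i : X → ℕ)

/-- In the Cayley graph in which a class of `E` sits through the cocycle `c` based at `x`, the
point `y` of the class of `x` is the nearest one to the vertex `v`. -/
def IsNearest (x : X) (v : FreeGroup ℕ) (y : X) : Prop :=
  E x y ∧ ∀ z, E x z → ¬ FreeGroup.ShortlexLT (c x z * v⁻¹, i z) (c x y * v⁻¹, i y)

/-- The relation that contracts the Cayley graph of the free group onto the classes of `E`. -/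
def ContractRel (x y : X) : Prop :=
  (∃ v s, IsNearest E c i x v x ∧ IsNearest E c i x (FreeGroup.mk [s] * v) y) ∨
    IsNearest E c i x 1 y

variable {E c i}

theorem ContractRel.rel {x y : X} (h : ContractRel E c i x y) : E x y := by
  rcases h with ⟨v, s, -, h⟩ | h <;> exact h.1

/-- By the cocycle identity, the change of base point is right translation by `c x x'`, which
cancels in `c x z * v⁻¹`. This lets `ContractRel` be defined with its first argument as base point.
-/
theorem isNearest_base_change (hc : ∀ x y z, E x y → E y z → c y z * c x y = c x z) {x x' : X}
    (hx : E x x') (v : FreeGroup ℕ) (y : X) :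
    IsNearest E c i x (v * c x x') y ↔ IsNearest E c i x' v y := by
  have h : ∀ z, E x z → c x z * (v * c x x')⁻¹ = c x' z * v⁻¹ := fun z hz => by
    rw [← hc x x' z hx (E.trans (E.symm hx) hz), mul_inv_rev, ← mul_assoc, mul_inv_cancel_right]
  constructor
  · rintro ⟨hy, H⟩
    refine ⟨E.trans (E.symm hx) hy, fun z hz => ?_⟩
    have := H z (E.trans hx hz)
    rwa [h z (E.trans hx hz), h y hy] at this
  · rintro ⟨hy, H⟩
    refine ⟨E.trans hx hy, fun z hz => ?_⟩
    rw [h z hz, h y (E.trans hx hy)]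
    exact H z (E.trans (E.symm hx) hz)

/-- On the class of `x`, the relation `ContractRel` gives a contraction of the Cayley graph of the
free group. -/
theorem exists_contract_of_cocycle (hc : ∀ x y z, E x y → E y z → c y z * c x y = c x z)
    (hci : ∀ x y, E x y → c x y = 1 → i x = i y → x = y) (x : X) :
    ∃ (φ : {y // E x y} → FreeGroup ℕ) (π : FreeGroup ℕ → {y // E x y}),
      (∀ v, Relation.ReflTransGen
        (fun u w => (FreeGroup.cayleyGraph ℕ).Adj u w ∧ π u = π w) v (φ (π v))) ∧
      ∀ a b, ((FreeGroup.cayleyGraph ℕ).contract φ π).Adj a b ↔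
        (SimpleGraph.fromRel (ContractRel E c i)).Adj a.1 b.1 := by
  let φ : {y // E x y} → FreeGroup ℕ := fun y => c x y
  have hinj : ∀ a b : {y // E x y}, φ a = φ b → i a = i b → a = b := fun a b hab hi => by
    refine Subtype.ext (hci a b (E.trans (E.symm a.2) b.2) ?_ hi)
    have := hc x a b a.2 (E.trans (E.symm a.2) b.2)
    change c x a = c x b at hab
    rw [hab] at this
    simpa using this
  have hex : ∀ v, ∃ y : {y // E x y}, IsNearest E c i x v y := by
    intro v
    obtain ⟨_, ⟨y, rfl⟩, hy⟩ := FreeGroup.shortlexLT_wellFounded.has_min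
      (Set.range fun y : {y // E x y} => (c x y * v⁻¹, i y)) ⟨_, ⟨x, E.refl x⟩, rfl⟩
    exact ⟨y, y.2, fun z hz => hy _ ⟨⟨z, hz⟩, rfl⟩⟩
  choose π hπ using hex
  have huniq : ∀ v (y : {y // E x y}), IsNearest E c i x v y ↔ π v = y := by
    refine fun v y => ⟨fun h => ?_, fun h => h ▸ hπ v⟩
    have := FreeGroup.eq_of_not_shortlexLT (h.2 _ (π v).2) ((hπ v).2 _ y.2)
    rw [Prod.mk.injEq, mul_left_inj] at this
    exact hinj _ _ this.1 this.2
  have hrel : ∀ a b : {y // E x y}, ContractRel E c i a b ↔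
      (∃ v w, (FreeGroup.cayleyGraph ℕ).Adj v w ∧ π v = a ∧ π w = b) ∨ π (φ a) = b := by
    intro a b
    -- Moving the base point from `a` to `x` turns the vertex `1` into `c x a = φ a`.
    simp only [ContractRel, ← isNearest_base_change hc a.2, huniq, one_mul]
    refine or_congr ⟨?_, ?_⟩ Iff.rfl
    · rintro ⟨v, s, h1, h2⟩
      exact ⟨_, _, FreeGroup.cayleyGraph_adj.2 ⟨s, (mul_assoc _ _ _).symm⟩, h1, h2⟩
    · rintro ⟨v, w, hvw, h1, h2⟩
      obtain ⟨s, rfl⟩ := FreeGroup.cayleyGraph_adj.1 hvw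
      refine ⟨v * (c x a)⁻¹, s, ?_, ?_⟩
      · rwa [inv_mul_cancel_right]
      · rwa [mul_assoc, inv_mul_cancel_right]
  refine ⟨φ, π, FreeGroup.reflTransGen_of_nearest hinj fun v y => (hπ v).2 y y.2, fun a b => ?_⟩
  rw [SimpleGraph.contract, SimpleGraph.fromRel_adj, SimpleGraph.fromRel_adj, hrel, hrel,
    Ne, Ne, Subtype.ext_iff]

theorem reachable_fromRel_contractRel_iff (hc : ∀ x y z, E x y → E y z → c y z * c x y = c x z)
    (hci : ∀ x y, E x y → c x y = 1 → i x = i y → x = y) (x y : X) :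
    (SimpleGraph.fromRel (ContractRel E c i)).Reachable x y ↔ E x y := by
  constructor
  · intro h
    rw [SimpleGraph.reachable_iff_reflTransGen] at h
    induction h with
    | refl => exact E.refl x
    | tail _ h ih =>
      rw [SimpleGraph.fromRel_adj] at h
      exact E.trans ih (h.2.elim ContractRel.rel fun h => E.symm h.rel)
  · intro h
    obtain ⟨φ, π, -, hadj⟩ := exists_contract_of_cocycle hc hci x
    have := SimpleGraph.contract_preconnected (φ := φ) (π := π)
      FreeGroup.cayleyGraph_preconnected ⟨x, E.refl x⟩ ⟨y, h⟩
    exact this.map (⟨Subtype.val, fun {a b} hab => (hadj a b).1 hab⟩ :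
      (FreeGroup.cayleyGraph ℕ).contract φ π →g SimpleGraph.fromRel (ContractRel E c i))

theorem isAcyclic_fromRel_contractRel (hc : ∀ x y z, E x y → E y z → c y z * c x y = c x z)
    (hci : ∀ x y, E x y → c x y = 1 → i x = i y → x = y) :
    (SimpleGraph.fromRel (ContractRel E c i)).IsAcyclic := by
  rw [SimpleGraph.isAcyclic_iff_forall_adj_isBridge]
  intro x y hxy
  obtain ⟨φ, π, hπ, hadj⟩ := exists_contract_of_cocycle hc hci x
  have hE : ∀ a b, (SimpleGraph.fromRel (ContractRel E c i)).Adj a b → E a b := fun a b h =>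
    (reachable_fromRel_contractRel_iff hc hci a b).1 h.reachable
  have hac := SimpleGraph.contract_isAcyclic FreeGroup.cayleyGraph_isAcyclic hπ
  have hbr := SimpleGraph.isAcyclic_iff_forall_adj_isBridge.1 hac
    ((hadj ⟨x, E.refl x⟩ ⟨y, hE x y hxy⟩).2 hxy)
  rw [SimpleGraph.isBridge_iff] at hbr ⊢
  intro hreach
  -- Paths from `x` stay in its class, where the graph is the contracted tree.
  have key : ∀ z, ((SimpleGraph.fromRel (ContractRel E c i)).deleteEdges {s(x, y)}).Reachable x z →
      ∃ h : E x z, (((FreeGroup.cayleyGraph ℕ).contract φ π).deleteEdges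
        {s(⟨x, E.refl x⟩, ⟨y, hE x y hxy⟩)}).Reachable ⟨x, E.refl x⟩ ⟨z, h⟩ := by
    intro z hz
    rw [SimpleGraph.reachable_iff_reflTransGen] at hz
    induction hz with
    | refl => exact ⟨E.refl x, .rfl⟩
    | @tail a b _ hab ih =>
      obtain ⟨ha, ih⟩ := ih
      rw [SimpleGraph.deleteEdges_adj] at hab
      have hb := E.trans ha (hE a b hab.1)
      refine ⟨hb, ih.trans (SimpleGraph.Adj.reachable ?_)⟩
      rw [SimpleGraph.deleteEdges_adj]
      refine ⟨(hadj ⟨a, ha⟩ ⟨b, hb⟩).2 hab.1, fun h => hab.2 ?_⟩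
      exact congrArg (Sym2.map Subtype.val) (Set.mem_singleton_iff.1 h)
  exact hbr (key y hreach).2

/-- A countable Borel equivalence relation is treeable if it has a Borel cocycle into a free group
whose kernel is smooth, as witnessed by a Borel map `i` to `ℕ`. -/
theorem isTreeable_of_cocycle [MeasurableSpace X] [StandardBorelSpace X] (hE : IsCountableBorel E)
    (hc : ∀ x y z, E x y → E y z → c y z * c x y = c x z)
    (hcm : ∀ g : X → X, Measurable g → (∀ x, E x (g x)) → Measurable fun x => c x (g x))
    (hi : Measurable i) (hci : ∀ x y, E x y → c x y = 1 → i x = i y → x = y) :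
    IsTreeable E := by
  obtain ⟨g, hg, -, hgE⟩ := hE.exists_involutive
  have hgE' : ∀ n x, E x (g n x) := fun n x => (hgE _ _).2 ⟨n, rfl⟩
  have hkey : ∀ h : X → X, Measurable h → (∀ x, E x (h x)) → ∀ v : FreeGroup ℕ,
      Measurable fun x => (c x (h x) * v⁻¹, i (h x)) := fun h hh hhE v =>
    ((hcm h hh hhE).mul_const _).prodMk (hi.comp hh)
  have hnear : ∀ h : X → X, Measurable h → (∀ x, E x (h x)) → ∀ v : FreeGroup ℕ,
      MeasurableSet {x | IsNearest E c i x v (h x)} := by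
    intro h hh hhE v
    -- The functions `g n` enumerate each class, so the quantifier over the class becomes a
    -- countable intersection.
    have : {x | IsNearest E c i x v (h x)} = ⋂ n, {x | FreeGroup.ShortlexLT
        (c x (g n x) * v⁻¹, i (g n x)) (c x (h x) * v⁻¹, i (h x))}ᶜ := by
      ext x
      simp only [IsNearest, Set.mem_iInter, Set.mem_compl_iff, Set.mem_ofPred_eq, hhE, true_and]
      refine ⟨fun H n => H _ (hgE' n x), fun H z hz => ?_⟩
      obtain ⟨n, rfl⟩ := (hgE x z).1 hz
      exact H n
    rw [this]
    refine MeasurableSet.iInter fun n => MeasurableSet.compl ?_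
    exact ((hkey _ (hg n) (hgE' n) v).prodMk (hkey _ hh hhE v))
      (MeasurableSet.of_discrete (s := {p | FreeGroup.ShortlexLT p.1 p.2}))
  have hrel : MeasurableSet {p : X × X | ContractRel E c i p.1 p.2} := by
    have : {p : X × X | ContractRel E c i p.1 p.2} = ⋃ n, {p : X × X | g n p.1 = p.2} ∩
        Prod.fst ⁻¹' ((⋃ v : FreeGroup ℕ, ⋃ s : ℕ × Bool, {x | IsNearest E c i x v x} ∩
          {x | IsNearest E c i x (FreeGroup.mk [s] * v) (g n x)}) ∪
            {x | IsNearest E c i x 1 (g n x)}) := by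
      ext ⟨x, y⟩
      simp only [Set.mem_iUnion, Set.mem_inter_iff, Set.mem_ofPred_eq, Set.mem_preimage,
        Set.mem_union]
      constructor
      · intro h
        obtain ⟨n, rfl⟩ := (hgE x y).1 h.rel
        exact ⟨n, rfl, h⟩
      · rintro ⟨n, rfl, h⟩
        exact h
    rw [this]
    refine MeasurableSet.iUnion fun n => MeasurableSet.inter
      (measurableSet_eq_fun ((hg n).comp measurable_fst) measurable_snd)
      (measurable_fst (MeasurableSet.union ?_ (hnear _ (hg n) (hgE' n) _)))
    exact MeasurableSet.iUnion fun v => MeasurableSet.iUnion fun s =>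
      (hnear _ measurable_id E.refl v).inter (hnear _ (hg n) (hgE' n) _)
  refine ⟨SimpleGraph.fromRel (ContractRel E c i), ?_, isAcyclic_fromRel_contractRel hc hci,
    reachable_fromRel_contractRel_iff hc hci⟩
  have : {p : X × X | (SimpleGraph.fromRel (ContractRel E c i)).Adj p.1 p.2} =
      {p : X × X | p.1 = p.2}ᶜ ∩ ({p : X × X | ContractRel E c i p.1 p.2} ∪
        Prod.swap ⁻¹' {p : X × X | ContractRel E c i p.1 p.2}) := by
    ext ⟨x, y⟩
    exact SimpleGraph.fromRel_adj _ _ _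
  rw [this]
  exact (measurableSet_eq_fun measurable_fst measurable_snd).compl.inter
    (hrel.union (measurable_swap hrel))

end Treeability

/-! ### Reductions to free group actions, and the main theorem -/

/-- If `E`, as a principal groupoid, is Borel reducible to the groupoid of a Borel action of the
free group, then `E` is treeable. -/
theorem isTreeable_of_borelReducible {X Y : Type*} [MeasurableSpace X] [StandardBorelSpace X]
    [MeasurableSpace Y] [StandardBorelSpace Y] {E : Setoid X} (hE : IsCountableBorel E)
    [MulAction (FreeGroup ℕ) Y] [MeasurableSMul₂ (FreeGroup ℕ) Y]
    (h : (principalBorelGroupoid E hE.measurableSet).BorelReducible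
      (actionBorelGroupoid (FreeGroup ℕ) Y)) : IsTreeable E := by
  classical
  obtain ⟨F, hF, hred⟩ := h
  let G := principalBorelGroupoid E hE.measurableSet
  let arr : ∀ x y : X, E x y → ((show G.Obj from x) ⟶ (show G.Obj from y)) := fun x y h => ⟨h⟩
  let f : X → Y := fun x => F.obj x
  -- The value `1` off `E` is never used.
  let c : X → X → FreeGroup ℕ := fun x y => if h : E x y then (F.map (arr x y h)).1 else 1
  have hcE : ∀ x y (h : E x y), c x y = (F.map (arr x y h)).1 := fun x y h => dif_pos h
  have hcf : ∀ x y, E x y → c x y • f x = f y := fun x y h => by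
    rw [hcE x y h]
    exact (F.map (arr x y h)).2
  have hfE : ∀ x y, f x = f y → E x y := fun x y h => by
    obtain ⟨k⟩ := hred x y ⟨⟨1, (one_smul _ (f x)).trans h⟩⟩
    exact k.down
  have hF' : Measurable fun γ : Arrow G.Obj =>
      (((F.map γ.hom).1, F.obj γ.left) : FreeGroup ℕ × Y) :=
    measurable_comap_iff.1 hF
  have harr : ∀ g : X → X, Measurable g → ∀ hg : ∀ x, E x (g x),
      Measurable fun x => Arrow.mk (arr x (g x) (hg x)) := fun g hgm hg =>
    measurable_comap_iff.2 (Measurable.subtype_mk (measurable_id.prodMk hgm))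
  have hf : Measurable f := measurable_snd.comp (hF'.comp (harr id measurable_id E.refl))
  have hcm : ∀ g : X → X, Measurable g → (∀ x, E x (g x)) → Measurable fun x => c x (g x) := by
    intro g hgm hg
    have := measurable_fst.comp (hF'.comp (harr g hgm hg))
    convert this using 1
    exact funext fun x => hcE x (g x) (hg x)
  have hc : ∀ x y z, E x y → E y z → c y z * c x y = c x z := by
    intro x y z hxy hyz
    rw [hcE x y hxy, hcE y z hyz, hcE x z (E.trans hxy hyz)]
    exact (congrArg Subtype.val (F.map_comp (arr x y hxy) (arr y z hyz))).symm
  -- Each fibre of `f` lies in one class of `E`, hence is countable.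
  obtain ⟨B, hB, hBi, hBU⟩ := exists_measurableSet_injOn_of_countable_fiber hf fun y => by
    rcases (f ⁻¹' {y}).eq_empty_or_nonempty with h | ⟨x, rfl⟩
    · rw [h]
      exact Set.countable_empty
    · exact (hE.countable_class x).mono fun z hz => hfE x z hz.symm
  have hex : ∀ x, ∃ n, x ∈ B n := fun x => Set.mem_iUnion.1 (hBU.ge (Set.mem_univ x))
  refine isTreeable_of_cocycle (i := fun x => Nat.find (hex x)) hE hc hcm
    (measurable_find hex fun n => hB n) fun x y hxy hcxy hi => ?_
  have h1 := hcf x y hxy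
  rw [hcxy, one_smul] at h1
  have h2 := Nat.find_spec (hex x)
  have h3 := Nat.find_spec (hex y)
  rw [← hi] at h3
  exact hBi _ h2 h3 h1

/-- A countable Borel equivalence relation is the orbit equivalence relation of a Borel action of
the free group on countably many generators. -/
theorem IsCountableBorel.exists_mulAction_freeGroup {X : Type u} [MeasurableSpace X]
    [StandardBorelSpace X] {E : Setoid X} (hE : IsCountableBorel E) :
    ∃ (_ : MulAction (FreeGroup ℕ) X) (_ : MeasurableSMul₂ (FreeGroup ℕ) X),
      ∀ x y : X, E x y ↔ ∃ γ : FreeGroup ℕ, γ • x = y := by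
  obtain ⟨g, hg, hgi, hgE⟩ := hE.exists_involutive
  let ρ : FreeGroup ℕ →* Equiv.Perm X := FreeGroup.lift fun n => (hgi n).toPerm
  have hρ : ∀ γ, Measurable (ρ γ) ∧ ∀ x, E x (ρ γ x) := by
    intro γ
    have hof : ∀ n, Measurable (ρ (FreeGroup.of n)) ∧ ∀ x, E x (ρ (FreeGroup.of n) x) := by
      intro n
      have : (ρ (FreeGroup.of n) : X → X) = g n := by
        simp only [ρ, FreeGroup.lift_apply_of]
        rfl
      rw [this]
      exact ⟨hg n, fun x => (hgE _ _).2 ⟨n, rfl⟩⟩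
    -- An involution is its own inverse.
    have hinv : ∀ n, ρ (FreeGroup.of n)⁻¹ = ρ (FreeGroup.of n) := by
      intro n
      rw [map_inv]
      simp only [ρ, FreeGroup.lift_apply_of]
      rfl
    induction γ using FreeGroup.induction_on with
    | C1 =>
      rw [map_one]
      exact ⟨measurable_id, E.refl⟩
    | of n => exact hof n
    | inv_of n _ => rw [hinv]; exact hof n
    | mul a b ha hb =>
      rw [map_mul]
      exact ⟨ha.1.comp hb.1, fun x => E.trans (hb.2 x) (ha.2 _)⟩
  let act : MulAction (FreeGroup ℕ) X := MulAction.compHom X ρ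
  refine ⟨act, ⟨?_⟩, fun x y => ⟨fun h => ?_, ?_⟩⟩
  · exact measurable_from_prod_countable_right fun γ => (hρ γ).1
  · obtain ⟨n, rfl⟩ := (hgE x y).1 h
    refine ⟨FreeGroup.of n, ?_⟩
    change ρ (FreeGroup.of n) x = g n x
    simp only [ρ, FreeGroup.lift_apply_of]
    rfl
  · rintro ⟨γ, rfl⟩
    exact (hρ γ).2 x

theorem principalBorelGroupoid_isCountable {X : Type u} [MeasurableSpace X] [StandardBorelSpace X]
    {E : Setoid X} (hE : IsCountableBorel E) :
    (principalBorelGroupoid E hE.measurableSet).IsCountable := by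
  intro x
  refine Set.countable_of_injective_of_countable_image
    (f := fun γ => (principalArrowEquiv E γ).1.2) ?_ ((hE.countable_class x).mono ?_)
  · rintro γ (rfl : γ.left = _) γ' (h : γ'.left = _) hγ
    exact (principalArrowEquiv E).injective (Subtype.ext (Prod.ext h.symm hγ))
  · rintro _ ⟨γ, rfl, rfl⟩
    exact γ.hom.down

theorem actionBorelGroupoid_isCountable (Γ : Type v) [Group Γ] (X : Type u) [MulAction Γ X]
    [Countable Γ] [MeasurableSpace Γ] [DiscreteMeasurableSpace Γ]
    [MeasurableSpace X] [StandardBorelSpace X] [MeasurableSMul₂ Γ X] :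
    (actionBorelGroupoid Γ X).IsCountable := by
  intro x
  refine Set.countable_of_injective_of_countable_image
    (f := fun γ => (actionArrowEquiv Γ X γ).1) ?_ (Set.to_countable _)
  rintro γ (h : γ.left = _) γ' (h' : γ'.left = _) hγ
  exact (actionArrowEquiv Γ X).injective (Prod.ext hγ (h.trans h'.symm))

theorem mainTheorem4 {X : Type u} [MeasurableSpace X] [StandardBorelSpace X] (E : Setoid X)
    (hE : IsCountableBorel E) (hnt : ¬ IsTreeable E) :
    (∃ G H : BorelGroupoid.{u, 0} X, G.IsCountable ∧ H.IsCountable ∧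
      G.orbitRel = E ∧ H.orbitRel = E ∧ ¬ G.BorelReducible H) ∧
    ∃ (_ : MulAction (FreeGroup ℕ) X) (_ : MeasurableSMul₂ (FreeGroup ℕ) X),
      (principalBorelGroupoid E hE.measurableSet).IsCountable ∧
      (actionBorelGroupoid (FreeGroup ℕ) X).IsCountable ∧
      (principalBorelGroupoid E hE.measurableSet).orbitRel = E ∧
      (actionBorelGroupoid (FreeGroup ℕ) X).orbitRel = E ∧
      ¬ (principalBorelGroupoid E hE.measurableSet).BorelReducible
          (actionBorelGroupoid (FreeGroup ℕ) X) := by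
  obtain ⟨_, _, hact⟩ := hE.exists_mulAction_freeGroup
  have h1 := principalBorelGroupoid_isCountable hE
  have h2 := actionBorelGroupoid_isCountable (FreeGroup ℕ) X
  have h3 : (principalBorelGroupoid E hE.measurableSet).orbitRel = E :=
    Setoid.ext fun x y => ⟨fun ⟨k⟩ => k.down, fun h => ⟨⟨h⟩⟩⟩
  have h4 : (actionBorelGroupoid (FreeGroup ℕ) X).orbitRel = E :=
    Setoid.ext fun x y => ⟨fun ⟨k⟩ => (hact x y).2 ⟨k.1, k.2⟩, fun h =>
      let ⟨γ, hγ⟩ := (hact x y).1 h; ⟨⟨γ, hγ⟩⟩⟩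
  have h5 : ¬ (principalBorelGroupoid E hE.measurableSet).BorelReducible
      (actionBorelGroupoid (FreeGroup ℕ) X) := fun h => hnt (isTreeable_of_borelReducible hE h)
  exact ⟨⟨_, _, h1, h2, h3, h4, h5⟩, _, _, h1, h2, h3, h4, h5⟩
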